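/- For $\sigma>0$ let $\psi(t,x)=\exp\!\left(-\frac{|t-x|^2}{2\sigma^2}\right)$ be the Gaussian embedder on $\mathbb{R}^2$. For $d\ge 1$ let $\Psi(x)=[\psi(0,x),\psi(\tfrac1d,x),\dots,\psi(\tfrac{d-1}{d},x)]^T\in\mathbb{R}^d$ be the $d$-dimensional embedding of a coordinate $x\in[0,1]$, and for coordinates $x_1,\dots,x_N\in[0,1]$ let $A=[\Psi(x_1)\,\cdots\,\Psi(x_N)]\in\mathbb{R}^{d\times N}$ be the embedding matrix, with stable rank $\mathrm{sr}(A)=\|A\|_F^2/\|A\|_2^2$ (Frobenius norm and spectral norm). Put $m=\min\!\left(N,\frac{1}{2\sqrt{\pi}\,\sigma}\right)$. With a sufficiently large embedding dimension and small $\sigma$, the stable rank is $m$ and the embedded distance is $\sqrt\pi\,\sigma\exp\!\left(-\frac{|x_1-x_2|^2}{4\sigma^2}\right)$, in the following precise sense. (1) Equidistant coordinates. Let $\theta\in[0,1]$ and $x_j=\frac{j+\theta}{N}$ for $j=0,\dots,N-1$. For every $\varepsilon>0$ there is $\delta>0$ such that for every $0<\sigma<\delta$ there is $d_0$ such that for all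 $d\ge d_0$ and all $N\ge1$ (if $\theta\in\{0,1\}$: all $N\ge 1/\delta$), $$\tfrac{9}{10}\,m\le \mathrm{sr}(A)\le(1+\varepsilon)\,m,$$ and $|\mathrm{sr}(A)-m|\le\varepsilon\, m$ whenever $N\sigma\le\delta$ or $N\sigma\ge1/\delta$. (2) Arbitrary coordinates. Let $x_1,\dots,x_N\in(0,1)$ be distinct. For every $\varepsilon>0$ there is $\delta>0$ such that for every $0<\sigma<\delta$ there is $d_0$ such that $|\mathrm{sr}(A)-m|\le\varepsilon\, m$ for all $d\ge d_0$. (3) For all $\sigma>0$ and $x_1,x_2\in\mathbb{R}$, $\displaystyle\int_{-\infty}^{\infty}\psi(t,x_1)\psi(t,x_2)\,dt=\sqrt{\pi}\,\sigma\exp\!\left(-\frac{|x_1-x_2|^2}{4\sigma^2}\right)$. (4) Let $0<a$ and $b<1$. For every $\varepsilon>0$ there is $\delta>0$ such that for every $0<\sigma<\delta$: for all $x_1,x_2\in[a,b]$ the embedded distance $\mathrm D(x_1,x_2)=\int_0^1\psi(t,x_1)\psi(t,x_2)\,dt$ differs from $E=\sqrt{\pi}\,\sigma\exp\!\left(-\frac{|x_1-x_2|^2}{4\sigma^2}\right)$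 by at most $\varepsilon E$; and there is $d_0$ such that for all $d\ge d_0$ and all $x_1,x_2\in[a,b]$ the normalized inner product $\frac1d\langle\Psi(x_1),\Psi(x_2)\rangle$ also differs from $E$ by at most $\varepsilon E$. -/

import Mathlib

open MeasureTheory Set

noncomputable section

/-- The Gaussian embedder `ψ(t, x) = exp (-|t - x|² / (2σ²))` with standard deviation `σ`. -/
def gaussianEmbedder (σ t x : ℝ) : ℝ :=
  Real.exp (-|t - x| ^ 2 / (2 * σ ^ 2))

/-- The embedding `Ψ(x) = (ψ(0, x), ψ(s, x), …, ψ((d - 1) s, x))` of a coordinate `x ∈ [0, 1]` in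
dimension `d`, with sampling interval `s = 1 / d`. -/
def gaussianEmbedding (σ : ℝ) (d : ℕ) (x : ℝ) : Fin d → ℝ :=
  fun i => gaussianEmbedder σ ((i : ℝ) * (1 / (d : ℝ))) x

/-- The `d × N` embedding matrix, with columns `Ψ(x_1), …, Ψ(x_N)`. -/
def gaussianEmbeddingMatrix (σ : ℝ) (d : ℕ) {N : ℕ} (x : Fin N → ℝ) :
    Matrix (Fin d) (Fin N) ℝ :=
  Matrix.of fun i j => gaussianEmbedding σ d (x j) i

/-- The stable rank `‖A‖_F² / ‖A‖_2²`, where `‖A‖_2` is the operator norm of `A` between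
Euclidean spaces. -/
def stableRank {m n : ℕ} (A : Matrix (Fin m) (Fin n) ℝ) : ℝ :=
  (∑ i, ∑ j, A i j ^ 2) / ‖LinearMap.toContinuousLinearMap (Matrix.toEuclideanLin A)‖ ^ 2

/-- The embedded distance `D(x₁, x₂) = ∫ ψ(t, x₁) ψ(t, x₂) dt`, with `t` ranging over `S`. -/
def embeddedDistance (S : Set ℝ) (σ x₁ x₂ : ℝ) : ℝ :=
  ∫ t in S, gaussianEmbedder σ t x₁ * gaussianEmbedder σ t x₂

/-- The embedded distance computed from the embedding vectors: the inner product of `Ψ(x₁)` and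
`Ψ(x₂)`, times the sampling interval `1 / d`. -/
def sampledDistance (σ : ℝ) (d : ℕ) (x₁ x₂ : ℝ) : ℝ :=
  (1 / (d : ℝ)) * ∑ i, gaussianEmbedding σ d x₁ i * gaussianEmbedding σ d x₂ i

/-- `N` equidistant coordinates in `[0, 1]` with spacing `1 / N` and offset `θ / N`. -/
def gridCoordinates (θ : ℝ) (N : ℕ) : Fin N → ℝ :=
  fun j => ((j : ℝ) + θ) / (N : ℝ)

end

/-! A product of two embedders is a Gaussian in `t` centred at the midpoint, times `exp (-(x - y)² /
(4σ²))`. Integrating in `t` gives the distance formula. On `[0, 1]`, and for Riemann sums with large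
`d`, the mass is still about `√π σ` unless the centre lies within `O(σ)` of an end point. So the
Gram matrix of `A` is nearly `d √π σ exp (-(x_j - x_k)² / (4σ²))`, and `‖A‖_F² ≈ d N √π σ`.

Upper bound: `‖A‖_2` dominates every column norm, so `sr ≤ N`; testing it on the constant vector
gives about `sr ≤ W := 1 / (2√π σ)`.

Lower bound: Schur's test bounds `‖A‖_2²` by the largest row sum of the Gram matrix. For fixed
distinct points the off-diagonal terms vanish as `σ → 0`. For the grid the row sums are at most
about `d √π σ` times the theta series at `1 / w²`, where `w = N / W`. The functional equation `θ(1 /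
w²) = w θ(w²)` bounds this series by `R * max 1 w`, where `R` bounds `θ` at an argument `≥ 1`. Since
`min N W = N / max 1 w`, the loss is only the factor `R`: always at most `11/10`, whence `9/10`, and
close to `1` when `w` is very small or very large. -/

/-! ### Riemann sums and Gaussian mass on the unit interval -/

theorem abs_riemannSum_sub_integral_le {f : ℝ → ℝ} {L : ℝ} (hf : Continuous f)
    (hL : ∀ s ∈ Icc (0 : ℝ) 1, ∀ t ∈ Icc (0 : ℝ) 1, |f s - f t| ≤ L * |s - t|)
    (hL0 : 0 ≤ L) {d : ℕ} (hd : 0 < d) :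
    |(1 / (d : ℝ)) * ∑ i : Fin d, f ((i : ℝ) * (1 / (d : ℝ))) - ∫ t in (0 : ℝ)..1, f t|
      ≤ L / d := by
  have hd' : (0 : ℝ) < d := by exact_mod_cast hd
  have hsum : ∑ k ∈ Finset.range d, ∫ t in ((k : ℝ) / d)..(((k + 1 : ℕ) : ℝ) / d), f t
      = ∫ t in (0 : ℝ)..1, f t := by
    have := intervalIntegral.sum_integral_adjacent_intervals (f := f) (μ := volume)
      (a := fun k : ℕ => (k : ℝ) / d) (n := d) (fun k _ => hf.intervalIntegrable _ _)
    simpa [div_self hd'.ne'] using this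
  have hterm : ∀ k ∈ Finset.range d,
      |(1 / (d : ℝ)) * f ((k : ℝ) * (1 / (d : ℝ)))
        - ∫ t in ((k : ℝ) / d)..(((k + 1 : ℕ) : ℝ) / d), f t| ≤ L / d * (1 / d) := by
    intro k hk
    have hkd : (k : ℝ) + 1 ≤ d := by exact_mod_cast Finset.mem_range.mp hk
    have hlen : ((k + 1 : ℕ) : ℝ) / d - (k : ℝ) / d = 1 / d := by push_cast; ring
    have hconst : (1 / (d : ℝ)) * f ((k : ℝ) * (1 / (d : ℝ)))
        = ∫ _ in ((k : ℝ) / d)..(((k + 1 : ℕ) : ℝ) / d), f ((k : ℝ) / d) := by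
      rw [intervalIntegral.integral_const, hlen, smul_eq_mul, mul_one_div]
    rw [hconst, ← intervalIntegral.integral_sub (by simp) (hf.intervalIntegrable _ _)]
    have hle : (k : ℝ) / d ≤ ((k + 1 : ℕ) : ℝ) / d := by
      have : 0 < 1 / (d : ℝ) := by positivity
      linarith
    have := intervalIntegral.norm_integral_le_of_norm_le_const
      (f := fun t => f ((k : ℝ) / d) - f t) (C := L / d)
      (a := (k : ℝ) / d) (b := ((k + 1 : ℕ) : ℝ) / d) ?_
    · rwa [hlen, abs_of_pos (by positivity : 0 < 1 / (d : ℝ)), Real.norm_eq_abs] at this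
    · intro t ht
      rw [uIoc_of_le hle] at ht
      have h0 : 0 ≤ (k : ℝ) / d := by positivity
      have h1 : ((k + 1 : ℕ) : ℝ) / d ≤ 1 := by
        rw [div_le_one hd']; push_cast; exact hkd
      have := hL ((k : ℝ) / d) ⟨h0, hle.trans h1⟩ t ⟨h0.trans ht.1.le, ht.2.trans h1⟩
      refine this.trans ?_
      rw [abs_sub_comm, abs_of_pos (sub_pos.mpr ht.1), div_eq_mul_one_div L]
      gcongr
      linarith [ht.2]
  rw [Fin.sum_univ_eq_sum_range (fun k : ℕ => f ((k : ℝ) * (1 / (d : ℝ)))) d, Finset.mul_sum,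
    ← hsum, ← Finset.sum_sub_distrib]
  refine (Finset.abs_sum_le_sum_abs _ _).trans ((Finset.sum_le_sum hterm).trans_eq ?_)
  rw [Finset.sum_const, Finset.card_range, nsmul_eq_mul]
  field_simp

theorem abs_exp_neg_sub_exp_neg_le {a b : ℝ} (ha : 0 ≤ a) (hb : 0 ≤ b) :
    |Real.exp (-a) - Real.exp (-b)| ≤ |a - b| := by
  wlog hab : a ≤ b generalizing a b
  · rw [abs_sub_comm, abs_sub_comm a]
    exact this hb ha (le_of_not_ge hab)
  have h1 : Real.exp (-b) ≤ Real.exp (-a) := Real.exp_le_exp.mpr (by linarith)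
  rw [abs_of_nonneg (sub_nonneg.mpr h1), abs_sub_comm, abs_of_nonneg (sub_nonneg.mpr hab)]
  have h2 : Real.exp (-b) = Real.exp (-a) * Real.exp (-(b - a)) := by
    rw [← Real.exp_add]; ring_nf
  have h3 := Real.add_one_le_exp (-(b - a))
  have h4 : Real.exp (-a) ≤ 1 := Real.exp_le_one_iff.mpr (by linarith)
  have h5 := Real.exp_pos (-a)
  rw [h2]
  nlinarith

noncomputable section

/-- The mass on `[0, 1]` of a Gaussian centred at `c`. -/
def gaussianMass (r c : ℝ) : ℝ :=
  ∫ t in (0 : ℝ)..1, Real.exp (-((t - c) / r) ^ 2)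

/-- The left Riemann sum of `gaussianMass r c` with `d` nodes. -/
def sampledMass (r : ℝ) (d : ℕ) (c : ℝ) : ℝ :=
  (1 / (d : ℝ)) * ∑ i : Fin d, Real.exp (-(((i : ℝ) * (1 / (d : ℝ)) - c) / r) ^ 2)

end

theorem abs_sampledMass_sub_gaussianMass_le {r c : ℝ} (hr : 0 < r) (hc : c ∈ Icc (0 : ℝ) 1)
    {d : ℕ} (hd : 0 < d) : |sampledMass r d c - gaussianMass r c| ≤ 2 / r ^ 2 / d := by
  refine abs_riemannSum_sub_integral_le (f := fun t => Real.exp (-((t - c) / r) ^ 2))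
    (by fun_prop) (fun s hs t ht => ?_) (by positivity) hd
  -- `exp (-·)` is 1-Lipschitz on `[0, ∞)`, so only the exponent matters; it factors through `s -
  -- t`, with `|s + t - 2c| ≤ 2`.
  refine (abs_exp_neg_sub_exp_neg_le (by positivity) (by positivity)).trans ?_
  have : ((s - c) / r) ^ 2 - ((t - c) / r) ^ 2 = (s + t - 2 * c) / r ^ 2 * (s - t) := by
    field_simp; ring
  rw [this, abs_mul, abs_div, abs_of_pos (by positivity : 0 < r ^ 2)]
  gcongr
  rw [abs_le]
  constructor <;> linarith [hs.1, hs.2, ht.1, ht.2, hc.1, hc.2]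

theorem integral_exp_neg_sq_div {r : ℝ} (hr : 0 < r) (c : ℝ) :
    ∫ t, Real.exp (-((t - c) / r) ^ 2) = √Real.pi * r := by
  have h1 := integral_sub_right_eq_self (μ := (volume : Measure ℝ))
    (fun t => Real.exp (-(t / r) ^ 2)) c
  rw [h1, Measure.integral_comp_div (fun t => Real.exp (-t ^ 2)) r]
  have := integral_gaussian 1
  simp only [neg_mul, one_mul, div_one] at this
  rw [this, abs_of_pos hr, smul_eq_mul, mul_comm]

theorem integrable_exp_neg_sq : Integrable fun t : ℝ => Real.exp (-t ^ 2) := by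
  simpa using integrable_exp_neg_mul_sq (zero_lt_one (α := ℝ))

theorem gaussianMass_eq {r : ℝ} (hr : 0 < r) (c : ℝ) :
    gaussianMass r c = r * ∫ t in (-c / r)..((1 - c) / r), Real.exp (-t ^ 2) := by
  unfold gaussianMass
  rw [intervalIntegral.integral_comp_sub_right (fun t => Real.exp (-(t / r) ^ 2)) c,
    intervalIntegral.integral_comp_div (fun t => Real.exp (-t ^ 2)) hr.ne', zero_sub, smul_eq_mul]

theorem gaussianMass_le {r c : ℝ} (hr : 0 < r) : gaussianMass r c ≤ √Real.pi * r := by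
  have hle : -c / r ≤ (1 - c) / r := by gcongr; linarith
  rw [gaussianMass_eq hr, mul_comm]
  gcongr
  rw [intervalIntegral.integral_of_le hle]
  have := integral_gaussian 1
  simp only [neg_mul, one_mul, div_one] at this
  rw [← this]
  exact setIntegral_le_integral integrable_exp_neg_sq
    (Filter.Eventually.of_forall fun _ => (Real.exp_pos _).le)

/-- Rescaling by `r` turns the mass into an integral of `exp (-t²)` over an interval containing
`[-L, L]`, so `L` depends on `ε` alone. -/
theorem exists_le_gaussianMass {ε : ℝ} (hε : 0 < ε) :
    ∃ L : ℝ, 0 < L ∧ ∀ r c : ℝ, 0 < r → L * r ≤ c → c ≤ 1 - L * r →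
      (1 - ε) * (√Real.pi * r) ≤ gaussianMass r c := by
  have hlim := intervalIntegral_tendsto_integral integrable_exp_neg_sq
    Filter.tendsto_neg_atTop_atBot Filter.tendsto_id
  have := integral_gaussian 1
  simp only [neg_mul, one_mul, div_one] at this
  rw [this] at hlim
  have hπ : 0 < √Real.pi := Real.sqrt_pos.mpr Real.pi_pos
  obtain ⟨L, hL, hL0⟩ := ((hlim.eventually_const_le
    (show (1 - ε) * √Real.pi < √Real.pi by nlinarith)).and (Filter.eventually_gt_atTop 0)).exists
  refine ⟨L, hL0, fun r c hr h1 h2 => ?_⟩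
  rw [gaussianMass_eq hr]
  have h3 : -c / r ≤ -L := by rw [div_le_iff₀ hr]; linarith
  have h4 : L ≤ (1 - c) / r := by rw [le_div_iff₀ hr]; linarith
  have := intervalIntegral.integral_mono_interval (μ := volume) h3 (by linarith : -L ≤ L) h4
    (f := fun t => Real.exp (-t ^ 2)) (Filter.Eventually.of_forall fun _ => (Real.exp_pos _).le)
    (integrable_exp_neg_sq.intervalIntegrable)
  have h5 := hL.trans this
  nlinarith

/-- The Lipschitz constant does not depend on the centre. This uniformity is what lets `d₀` be
chosen before `N`. -/
theorem exists_forall_abs_sampledMass_sub_le {r ε : ℝ} (hr : 0 < r) (hε : 0 < ε) :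
    ∃ d₀ : ℕ, 0 < d₀ ∧ ∀ d : ℕ, d₀ ≤ d → ∀ c ∈ Icc (0 : ℝ) 1,
      |sampledMass r d c - gaussianMass r c| ≤ ε * (√Real.pi * r) := by
  obtain ⟨n, hn⟩ := exists_nat_ge (2 / r ^ 2 / (ε * (√Real.pi * r)))
  refine ⟨n + 1, n.succ_pos, fun d hd c hc => ?_⟩
  have hd0 : 0 < d := by omega
  refine (abs_sampledMass_sub_gaussianMass_le hr hc hd0).trans ?_
  have hd' : (0 : ℝ) < d := by exact_mod_cast hd0
  have hnd : (n : ℝ) ≤ d := by exact_mod_cast (Nat.le_succ n).trans hd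
  rw [div_le_iff₀ (by positivity)] at hn
  rw [div_le_iff₀ hd']
  refine hn.trans ?_
  rw [mul_comm]
  gcongr

/-- The Riemann sum of a Gaussian on `[0, 1]` is close to the full Gaussian integral, from above
for all centres and from below for centres that stay away from the end points. -/
theorem exists_sampledMass_bounds {ε : ℝ} (hε : 0 < ε) :
    ∃ L : ℝ, 0 < L ∧ ∀ r : ℝ, 0 < r → ∃ d₀ : ℕ, 0 < d₀ ∧ ∀ d : ℕ, d₀ ≤ d →
      ∀ c ∈ Icc (0 : ℝ) 1, sampledMass r d c ≤ (1 + ε) * (√Real.pi * r) ∧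
        (L * r ≤ c → c ≤ 1 - L * r → (1 - ε) * (√Real.pi * r) ≤ sampledMass r d c) := by
  obtain ⟨L, hL, h⟩ := exists_le_gaussianMass (half_pos hε)
  refine ⟨L, hL, fun r hr => ?_⟩
  obtain ⟨d₀, hd₀, hd⟩ := exists_forall_abs_sampledMass_sub_le hr (half_pos hε)
  refine ⟨d₀, hd₀, fun d hdd c hc => ?_⟩
  have h1 := abs_le.mp (hd d hdd c hc)
  have h2 := gaussianMass_le (c := c) hr
  have h3 : 0 ≤ √Real.pi * r := by positivity
  refine ⟨by nlinarith, fun h4 h5 => ?_⟩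
  have := h r c hr h4 h5
  linarith

theorem sampledMass_nonneg (r : ℝ) (d : ℕ) (c : ℝ) : 0 ≤ sampledMass r d c := by
  unfold sampledMass; positivity

/-! ### Stable rank bounds for general matrices -/

theorem norm_toEuclideanLin_sq_apply {d N : ℕ} (A : Matrix (Fin d) (Fin N) ℝ)
    (v : EuclideanSpace ℝ (Fin N)) :
    ‖LinearMap.toContinuousLinearMap (Matrix.toEuclideanLin A) v‖ ^ 2
      = ∑ i, (∑ j, A i j * v j) ^ 2 := by
  simp [EuclideanSpace.norm_sq_eq, Matrix.toLpLin_apply, Matrix.mulVec, dotProduct]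

theorem sum_sq_le_opNorm_sq_mul {d N : ℕ} (A : Matrix (Fin d) (Fin N) ℝ) (v : Fin N → ℝ) :
    ∑ i, (∑ j, A i j * v j) ^ 2
      ≤ ‖LinearMap.toContinuousLinearMap (Matrix.toEuclideanLin A)‖ ^ 2 * ∑ j, v j ^ 2 := by
  have h := (LinearMap.toContinuousLinearMap (Matrix.toEuclideanLin A)).le_opNorm (WithLp.toLp 2 v)
  have h2 := pow_le_pow_left₀ (norm_nonneg _) h 2
  rw [norm_toEuclideanLin_sq_apply, mul_pow, EuclideanSpace.norm_sq_eq] at h2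
  simpa using h2

theorem stableRank_nonneg {d N : ℕ} (A : Matrix (Fin d) (Fin N) ℝ) : 0 ≤ stableRank A := by
  unfold stableRank; positivity

/-- Each column is the image of a unit vector, so its norm is at most the spectral norm. -/
theorem stableRank_le_card {d N : ℕ} (A : Matrix (Fin d) (Fin N) ℝ) : stableRank A ≤ N := by
  refine div_le_of_le_mul₀ (by positivity) (by positivity) ?_
  rw [Finset.sum_comm]
  have : ∀ j ∈ Finset.univ, ∑ i, A i j ^ 2
      ≤ ‖LinearMap.toContinuousLinearMap (Matrix.toEuclideanLin A)‖ ^ 2 := fun j _ => by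
    simpa [Pi.single_apply] using sum_sq_le_opNorm_sq_mul A (Pi.single j 1)
  refine (Finset.sum_le_sum this).trans_eq ?_
  simp

/-- Testing the spectral norm on the constant vector bounds the stable rank from above. -/
theorem stableRank_le_of_sum {d N : ℕ} (A : Matrix (Fin d) (Fin N) ℝ)
    (hS : 0 < ∑ i, ∑ j, A i j) :
    stableRank A ≤ d * N * (∑ i, ∑ j, A i j ^ 2) / (∑ i, ∑ j, A i j) ^ 2 := by
  set S := ∑ i, ∑ j, A i j with hSdef
  set F := ∑ i, ∑ j, A i j ^ 2 with hFdef
  set n := ‖LinearMap.toContinuousLinearMap (Matrix.toEuclideanLin A)‖ with hn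
  have h1 : S ^ 2 ≤ d * ∑ i, (∑ j, A i j) ^ 2 := by
    simpa using sq_sum_le_card_mul_sum_sq (s := Finset.univ) (f := fun i => ∑ j, A i j)
  have h2 : ∑ i, (∑ j, A i j) ^ 2 ≤ n ^ 2 * N := by
    simpa using sum_sq_le_opNorm_sq_mul A 1
  have h3 : S ^ 2 ≤ d * N * n ^ 2 := h1.trans (by nlinarith [(Nat.cast_nonneg d : (0 : ℝ) ≤ d)])
  have hF : 0 ≤ F := by positivity
  have hn2 : 0 < n ^ 2 := by
    have : 0 < S ^ 2 := by positivity
    rcases (sq_nonneg n).eq_or_lt with h | h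
    · rw [← h] at h3; linarith
    · exact h
  unfold stableRank
  rw [div_le_div_iff₀ hn2 (by positivity)]
  nlinarith

/-- Schur's test for a matrix with nonnegative entries. -/
theorem le_stableRank_of_rowSum_le {d N : ℕ} (A : Matrix (Fin d) (Fin N) ℝ)
    (hA : ∀ i j, 0 ≤ A i j) {M : ℝ} (hM : 0 < M) (hF : 0 < ∑ i, ∑ j, A i j ^ 2)
    (h : ∀ j, ∑ k, ∑ i, A i j * A i k ≤ M) :
    (∑ i, ∑ j, A i j ^ 2) / M ≤ stableRank A := by
  set n := ‖LinearMap.toContinuousLinearMap (Matrix.toEuclideanLin A)‖ with hn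
  have hle : n ≤ √M := by
    refine ContinuousLinearMap.opNorm_le_bound _ (Real.sqrt_nonneg _) fun v => ?_
    refine (pow_le_pow_iff_left₀ (norm_nonneg _) (by positivity) two_ne_zero).mp ?_
    rw [norm_toEuclideanLin_sq_apply, mul_pow, Real.sq_sqrt hM.le, EuclideanSpace.norm_sq_eq]
    -- Cauchy–Schwarz with the nonnegative weights `A i j`; summing over `i` then produces row sums
    -- of the Gram matrix.
    have h1 : ∀ i ∈ Finset.univ, (∑ j, A i j * v j) ^ 2
        ≤ (∑ k, A i k) * ∑ j, A i j * v j ^ 2 := fun i _ =>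
      Finset.sum_sq_le_sum_mul_sum_of_sq_le_mul _ (fun j _ => hA i j)
        (fun j _ => mul_nonneg (hA i j) (sq_nonneg _)) (fun j _ => by rw [mul_pow, sq (A i j), mul_assoc])
    refine (Finset.sum_le_sum h1).trans ?_
    have h2 : ∑ i, (∑ k, A i k) * ∑ j, A i j * v j ^ 2
        = ∑ j, (∑ k, ∑ i, A i j * A i k) * v j ^ 2 := by
      calc _ = ∑ i, ∑ j, ∑ k, A i j * A i k * v j ^ 2 :=
            Finset.sum_congr rfl fun i _ => by
              rw [Finset.mul_sum]
              refine Finset.sum_congr rfl fun j _ => ?_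
              rw [Finset.sum_mul]
              exact Finset.sum_congr rfl fun k _ => by ring
        _ = ∑ j, ∑ i, ∑ k, A i j * A i k * v j ^ 2 := Finset.sum_comm
        _ = _ := Finset.sum_congr rfl fun j _ => by
            rw [Finset.sum_comm, Finset.sum_mul]
            exact Finset.sum_congr rfl fun k _ => (Finset.sum_mul _ _ _).symm
    rw [h2, Finset.mul_sum]
    refine Finset.sum_le_sum fun j _ => ?_
    rw [Real.norm_eq_abs, sq_abs]
    exact mul_le_mul_of_nonneg_right (h j) (sq_nonneg _)
  have hn2 : n ^ 2 ≤ M := by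
    rw [← Real.sq_sqrt hM.le]; exact pow_le_pow_left₀ (norm_nonneg _) hle 2
  -- If the norm vanished, the quotient would be `0` by convention and the bound would fail; but
  -- then all columns vanish, against `hF`.
  have hn0 : 0 < n ^ 2 := by
    rcases (sq_nonneg n).eq_or_lt with h0 | h0
    · exfalso
      have h5 : ∀ j, ∑ i, A i j ^ 2 ≤ 0 := fun j => by
        have := sum_sq_le_opNorm_sq_mul A (Pi.single j 1)
        rw [← hn, ← h0] at this
        simpa [Pi.single_apply] using this
      rw [Finset.sum_comm] at hF
      exact absurd (Finset.sum_nonpos fun j _ => h5 j) (not_le.mpr hF)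
    · exact h0
  unfold stableRank
  gcongr

/-! ### The theta series -/

noncomputable section

/-- The theta series `∑ exp (-π a n²)` over the integers. -/
def thetaSum (a : ℝ) : ℝ := ∑' n : ℤ, Real.exp (-Real.pi * a * (n : ℝ) ^ 2)

end

theorem hasSum_pow_natAbs {q : ℝ} (h0 : 0 ≤ q) (h1 : q < 1) :
    HasSum (fun n : ℤ => q ^ n.natAbs) ((1 + q) / (1 - q)) := by
  have hg := hasSum_geometric_of_lt_one h0 h1
  have h := HasSum.of_nat_of_neg_add_one (f := fun n : ℤ => q ^ n.natAbs) (m := (1 - q)⁻¹)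
    (m' := q * (1 - q)⁻¹) (by simpa using hg) ?_
  · convert h using 1
    rw [div_eq_mul_inv]; ring
  · have hq : (fun n : ℕ => q ^ (-((n : ℤ) + 1)).natAbs) = fun n => q * q ^ n := by
      funext n
      rw [← pow_succ']
      congr 1
    rw [hq]
    exact hg.mul_left q

theorem exp_neg_mul_sq_le {a : ℝ} (ha : 0 < a) (n : ℤ) :
    Real.exp (-Real.pi * a * (n : ℝ) ^ 2) ≤ Real.exp (-Real.pi * a) ^ n.natAbs := by
  rw [← Real.exp_nat_mul, Real.exp_le_exp]
  have h1 : ((n.natAbs : ℕ) : ℝ) ≤ (n : ℝ) ^ 2 := by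
    have : n.natAbs ≤ n.natAbs ^ 2 := Nat.le_self_pow two_ne_zero _
    have h : ((n.natAbs : ℕ) : ℝ) ≤ ((n.natAbs : ℕ) : ℝ) ^ 2 := by exact_mod_cast this
    rwa [Nat.cast_natAbs, Int.cast_abs, sq_abs, ← Int.cast_abs, ← Nat.cast_natAbs] at h
  have : 0 < Real.pi * a := mul_pos Real.pi_pos ha
  nlinarith

theorem exp_neg_pi_mul_lt_one {a : ℝ} (ha : 0 < a) : Real.exp (-Real.pi * a) < 1 := by
  have : 0 < Real.pi * a := mul_pos Real.pi_pos ha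
  exact Real.exp_lt_one_iff.mpr (by linarith)

theorem summable_thetaSum {a : ℝ} (ha : 0 < a) :
    Summable fun n : ℤ => Real.exp (-Real.pi * a * (n : ℝ) ^ 2) :=
  (hasSum_pow_natAbs (Real.exp_pos _).le (exp_neg_pi_mul_lt_one ha)).summable.of_nonneg_of_le
    (fun _ => (Real.exp_pos _).le) (exp_neg_mul_sq_le ha)

/-- Comparison with a two-sided geometric series, using `n² ≥ |n|`. -/
theorem thetaSum_le {a : ℝ} (ha : 0 < a) :
    thetaSum a ≤ (1 + Real.exp (-Real.pi * a)) / (1 - Real.exp (-Real.pi * a)) := by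
  have h := hasSum_pow_natAbs (Real.exp_pos (-Real.pi * a)).le (exp_neg_pi_mul_lt_one ha)
  rw [← h.tsum_eq]
  exact (summable_thetaSum ha).tsum_le_tsum (exp_neg_mul_sq_le ha) h.summable

theorem thetaSum_le_of_exp_le {a ε : ℝ} (ha : 0 < a)
    (h : (2 + ε) * Real.exp (-Real.pi * a) ≤ ε) : thetaSum a ≤ 1 + ε := by
  refine (thetaSum_le ha).trans ?_
  rw [div_le_iff₀ (by linarith [exp_neg_pi_mul_lt_one ha])]
  linarith

theorem thetaSum_le_of_one_le {a : ℝ} (ha : 1 ≤ a) : thetaSum a ≤ 1 + 1 / 10 := by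
  refine thetaSum_le_of_exp_le (by linarith) ?_
  have h1 : Real.exp (-Real.pi * a) ≤ Real.exp (-3.14) :=
    Real.exp_le_exp.mpr (by nlinarith [Real.pi_gt_d2])
  -- With `ε = 1/10`, the requirement `(2 + ε) exp (-π a) ≤ ε` reads `exp (π a) ≥ 21`.
  have h2 : (21 : ℝ) ≤ Real.exp 3.14 := by
    have e1 : Real.exp 3.14 = Real.exp 1 ^ 3 * Real.exp 0.14 := by
      rw [← Real.exp_nat_mul, ← Real.exp_add]; norm_num
    have e2 := Real.exp_one_gt_d9
    have e3 := Real.add_one_le_exp (0.14 : ℝ)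
    have e4 : (2.7 : ℝ) ^ 3 ≤ Real.exp 1 ^ 3 := pow_le_pow_left₀ (by norm_num) (by linarith) 3
    rw [e1]
    nlinarith
  have h3 : Real.exp (-3.14) ≤ 1 / 21 := by
    rw [Real.exp_neg, inv_eq_one_div]
    exact one_div_le_one_div_of_le (by norm_num) h2
  linarith

theorem exists_thetaSum_le {ε : ℝ} (hε : 0 < ε) :
    ∃ a₀ : ℝ, 1 ≤ a₀ ∧ ∀ a : ℝ, a₀ ≤ a → thetaSum a ≤ 1 + ε := by
  refine ⟨max 1 ((2 + ε) / ε), le_max_left _ _, fun a ha => ?_⟩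
  have h1 : 1 ≤ a := (le_max_left _ _).trans ha
  have h2 : (2 + ε) / ε ≤ a := (le_max_right _ _).trans ha
  refine thetaSum_le_of_exp_le (by linarith) ?_
  have h3 : a ≤ Real.exp (Real.pi * a) := by
    nlinarith [Real.add_one_le_exp (Real.pi * a), Real.pi_gt_three]
  rw [div_le_iff₀ hε] at h2
  rw [neg_mul, Real.exp_neg, ← div_eq_mul_inv, div_le_iff₀ (Real.exp_pos _)]
  nlinarith

/-- Jacobi's functional equation, a case of Poisson summation. It handles dense grids (`w ≥ 1`),
where the series at `1 / w²` has many sizeable terms. -/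
theorem thetaSum_one_div_sq {w : ℝ} (hw : 0 < w) : thetaSum (1 / w ^ 2) = w * thetaSum (w ^ 2) := by
  have h := Real.tsum_exp_neg_mul_int_sq (a := 1 / w ^ 2) (by positivity)
  unfold thetaSum
  rw [h, ← Real.sqrt_eq_rpow, Real.sqrt_div zero_le_one, Real.sqrt_sq hw.le]
  simp

/-- The sums of a Gaussian over equidistant points are bounded by a theta series. -/
theorem sum_exp_grid_le {σ θ : ℝ} (hσ : 0 < σ) {N : ℕ} (j : Fin N) :
    ∑ k, Real.exp (-(gridCoordinates θ N j - gridCoordinates θ N k) ^ 2 / (4 * σ ^ 2))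
      ≤ thetaSum (1 / (2 * √Real.pi * σ * N) ^ 2) := by
  have hN : 0 < (N : ℝ) := by exact_mod_cast j.pos
  have hπ := Real.pi_pos
  have hw : 0 < 1 / (2 * √Real.pi * σ * N) ^ 2 := by positivity
  -- The offset `θ` cancels in differences, and the integers `j - k` are distinct, so the row sum is
  -- a partial sum of the series.
  have hinj : Function.Injective fun k : Fin N => (j : ℤ) - (k : ℤ) := fun k l hkl => by
    ext; simp at hkl; omega
  have hterm : ∀ k : Fin N,
      Real.exp (-(gridCoordinates θ N j - gridCoordinates θ N k) ^ 2 / (4 * σ ^ 2))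
        = Real.exp (-Real.pi * (1 / (2 * √Real.pi * σ * N) ^ 2)
            * (((j : ℤ) - (k : ℤ) : ℤ) : ℝ) ^ 2) := fun k => by
    congr 1
    simp only [gridCoordinates, mul_pow, Real.sq_sqrt hπ.le]
    push_cast
    field_simp
    ring
  simp_rw [hterm]
  unfold thetaSum
  rw [← tsum_fintype (L := .unconditional _)]
  exact Summable.tsum_le_tsum_of_inj (fun k : Fin N => (j : ℤ) - (k : ℤ)) hinj
    (fun _ _ => (Real.exp_pos _).le) (fun _ => le_rfl) (Summable.of_finite) (summable_thetaSum hw)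

/-! ### Embedder products and the Gram matrix -/

theorem gaussianEmbedder_mul (σ t x y : ℝ) :
    gaussianEmbedder σ t x * gaussianEmbedder σ t y
      = Real.exp (-(x - y) ^ 2 / (4 * σ ^ 2)) * Real.exp (-((t - (x + y) / 2) / σ) ^ 2) := by
  unfold gaussianEmbedder
  rw [← Real.exp_add, ← Real.exp_add, sq_abs, sq_abs]
  congr 1
  rcases eq_or_ne σ 0 with rfl | hσ
  · simp
  · field_simp; ring

/-- A single embedder has width `√2 σ` where a squared one has width `σ`; hence entry sums and
Frobenius sums use masses at different scales. -/
theorem gaussianEmbedder_eq (σ t x : ℝ) :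
    gaussianEmbedder σ t x = Real.exp (-((t - x) / (√2 * σ)) ^ 2) := by
  unfold gaussianEmbedder
  rw [sq_abs, div_pow, mul_pow, Real.sq_sqrt zero_le_two, neg_div]

theorem sampledDistance_eq (σ : ℝ) (d : ℕ) (x y : ℝ) :
    sampledDistance σ d x y
      = Real.exp (-(x - y) ^ 2 / (4 * σ ^ 2)) * sampledMass σ d ((x + y) / 2) := by
  unfold sampledDistance sampledMass gaussianEmbedding
  simp_rw [gaussianEmbedder_mul]
  rw [← Finset.mul_sum, mul_left_comm]

theorem embeddedDistance_univ {σ : ℝ} (hσ : 0 < σ) (x y : ℝ) :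
    embeddedDistance univ σ x y
      = √Real.pi * σ * Real.exp (-|x - y| ^ 2 / (4 * σ ^ 2)) := by
  unfold embeddedDistance
  simp_rw [gaussianEmbedder_mul]
  rw [setIntegral_univ, integral_const_mul, integral_exp_neg_sq_div hσ, sq_abs, mul_comm]

theorem embeddedDistance_Icc (σ x y : ℝ) :
    embeddedDistance (Icc 0 1) σ x y
      = Real.exp (-(x - y) ^ 2 / (4 * σ ^ 2)) * gaussianMass σ ((x + y) / 2) := by
  unfold embeddedDistance gaussianMass
  simp_rw [gaussianEmbedder_mul]
  rw [integral_const_mul, integral_Icc_eq_integral_Ioc,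
    intervalIntegral.integral_of_le zero_le_one]

theorem sum_mul_gaussianEmbeddingMatrix (σ : ℝ) {d N : ℕ} (hd : 0 < d) (x : Fin N → ℝ)
    (j k : Fin N) :
    ∑ i, gaussianEmbeddingMatrix σ d x i j * gaussianEmbeddingMatrix σ d x i k
      = d * (Real.exp (-(x j - x k) ^ 2 / (4 * σ ^ 2)) * sampledMass σ d ((x j + x k) / 2)) := by
  have hd' : (d : ℝ) ≠ 0 := by exact_mod_cast hd.ne'
  rw [← sampledDistance_eq, sampledDistance, ← mul_assoc, mul_one_div_cancel hd', one_mul]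
  rfl

theorem sum_sq_gaussianEmbeddingMatrix (σ : ℝ) {d N : ℕ} (hd : 0 < d) (x : Fin N → ℝ) :
    ∑ i, ∑ j, gaussianEmbeddingMatrix σ d x i j ^ 2 = d * ∑ j, sampledMass σ d (x j) := by
  rw [Finset.sum_comm, Finset.mul_sum]
  refine Finset.sum_congr rfl fun j _ => ?_
  simp_rw [sq]
  rw [sum_mul_gaussianEmbeddingMatrix σ hd]
  simp

theorem sum_gaussianEmbeddingMatrix (σ : ℝ) {d N : ℕ} (hd : 0 < d) (x : Fin N → ℝ) :
    ∑ i, ∑ j, gaussianEmbeddingMatrix σ d x i j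
      = d * ∑ j, sampledMass (√2 * σ) d (x j) := by
  have hd' : (d : ℝ) ≠ 0 := by exact_mod_cast hd.ne'
  rw [Finset.mul_sum]
  refine Finset.sum_comm.trans (Finset.sum_congr rfl fun j _ => ?_)
  rw [sampledMass, ← mul_assoc, mul_one_div_cancel hd', one_mul]
  exact Finset.sum_congr rfl fun i _ => gaussianEmbedder_eq _ _ _

/-- Bounds on the stable rank of an embedding matrix, given that the columns have on average almost
the full Gaussian mass. -/
theorem stableRank_gaussianEmbeddingMatrix_bounds {σ ε : ℝ} (hσ : 0 < σ) (hε : 0 < ε)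
    (hε1 : ε < 1) {d N : ℕ} (hd : 0 < d) (hN : 0 < N) {x : Fin N → ℝ}
    (hx : ∀ j, x j ∈ Icc (0 : ℝ) 1)
    (hup : ∀ c ∈ Icc (0 : ℝ) 1, sampledMass σ d c ≤ (1 + ε) * (√Real.pi * σ))
    (h1 : N * ((1 - ε) * (√Real.pi * σ)) ≤ ∑ j, sampledMass σ d (x j))
    (h2 : N * ((1 - ε) * (√Real.pi * (√2 * σ))) ≤ ∑ j, sampledMass (√2 * σ) d (x j)) :
    stableRank (gaussianEmbeddingMatrix σ d x)
        ≤ (1 + ε) / (1 - ε) ^ 2 * (1 / (2 * √Real.pi * σ)) ∧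
      ∀ R : ℝ, 0 < R → (∀ j, ∑ k, Real.exp (-(x j - x k) ^ 2 / (4 * σ ^ 2)) ≤ R) →
        (1 - ε) / (1 + ε) * (N / R) ≤ stableRank (gaussianEmbeddingMatrix σ d x) := by
  have hd' : (0 : ℝ) < d := by exact_mod_cast hd
  have hN' : (0 : ℝ) < N := by exact_mod_cast hN
  have hπ : 0 < √Real.pi := Real.sqrt_pos.mpr Real.pi_pos
  have h2pos : 0 < √(2 : ℝ) := by positivity
  have hε' : 0 < 1 - ε := by linarith
  have hF : ∑ j, sampledMass σ d (x j) ≤ N * ((1 + ε) * (√Real.pi * σ)) := by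
    simpa using Finset.sum_le_sum fun j (_ : j ∈ Finset.univ) => hup _ (hx j)
  have hFpos : 0 < ∑ j, sampledMass σ d (x j) := lt_of_lt_of_le (by positivity) h1
  have hSpos : 0 < ∑ j, sampledMass (√2 * σ) d (x j) := lt_of_lt_of_le (by positivity) h2
  constructor
  · have h := stableRank_le_of_sum (gaussianEmbeddingMatrix σ d x)
    rw [sum_gaussianEmbeddingMatrix σ hd, sum_sq_gaussianEmbeddingMatrix σ hd] at h
    refine (h (by positivity)).trans ?_
    calc _ ≤ d * N * (d * (N * ((1 + ε) * (√Real.pi * σ))))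
          / (d * (N * ((1 - ε) * (√Real.pi * (√2 * σ))))) ^ 2 := by gcongr
      _ = _ := by
        simp only [mul_pow, Real.sq_sqrt zero_le_two]
        field_simp
  · intro R hR hrow
    have hM : 0 < d * ((1 + ε) * (√Real.pi * σ) * R) := by positivity
    have h := le_stableRank_of_rowSum_le (gaussianEmbeddingMatrix σ d x)
      (fun i j => (Real.exp_pos _).le) hM
    rw [sum_sq_gaussianEmbeddingMatrix σ hd] at h
    refine le_trans ?_ (h (by positivity) fun j => ?_)
    · calc _ = d * (N * ((1 - ε) * (√Real.pi * σ))) / (d * ((1 + ε) * (√Real.pi * σ) * R)) := by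
            field_simp
        _ ≤ _ := by gcongr
    · simp_rw [sum_mul_gaussianEmbeddingMatrix σ hd]
      rw [← Finset.mul_sum]
      gcongr
      -- Only the upper mass bound is needed at midpoints, and it holds on all of `[0, 1]`.
      calc _ ≤ ∑ k, Real.exp (-(x j - x k) ^ 2 / (4 * σ ^ 2)) * ((1 + ε) * (√Real.pi * σ)) := by
            gcongr with k
            refine hup _ ⟨?_, ?_⟩ <;> linarith [(hx j).1, (hx j).2, (hx k).1, (hx k).2]
        _ ≤ _ := by
            rw [← Finset.sum_mul, mul_comm]
            gcongr
            exact hrow j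

/-! ### Equidistant coordinates near the end points -/

theorem gridCoordinates_mem_Icc {θ : ℝ} (hθ : θ ∈ Icc (0 : ℝ) 1) {N : ℕ} (j : Fin N) :
    gridCoordinates θ N j ∈ Icc (0 : ℝ) 1 := by
  have hN : 0 < (N : ℝ) := by exact_mod_cast j.pos
  have hj : (j : ℝ) + 1 ≤ N := by exact_mod_cast j.isLt
  have hj0 : (0 : ℝ) ≤ j := Nat.cast_nonneg _
  refine ⟨div_nonneg (by linarith [hθ.1]) hN.le, (div_le_one hN).mpr (by linarith [hθ.2])⟩

theorem sub_le_card_gridCoordinates {θ ℓ : ℝ} (hθ : θ ∈ Icc (0 : ℝ) 1) (hℓ : 0 ≤ ℓ) {N : ℕ}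
    (hN : 0 < N) :
    (N : ℝ) - 2 * (ℓ * N + 1)
      ≤ (Finset.univ.filter fun j : Fin N =>
          ℓ ≤ gridCoordinates θ N j ∧ gridCoordinates θ N j ≤ 1 - ℓ).card := by
  have hN' : 0 < (N : ℝ) := by exact_mod_cast hN
  -- Discarding `m` indices at each end suffices for every offset `θ ∈ [0, 1]`.
  set m := ⌈ℓ * N⌉₊ with hm
  have hm1 : ℓ * N ≤ m := Nat.le_ceil _
  have hm2 : (m : ℝ) < ℓ * N + 1 := Nat.ceil_lt_add_one (by positivity)
  have hmem : ∀ k ∈ Finset.Ico m (N - m), k < N := fun k hk => by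
    have := (Finset.mem_Ico.mp hk).2; omega
  have hsub : (Finset.Ico m (N - m)).attachFin hmem ⊆ Finset.univ.filter fun j : Fin N =>
      ℓ ≤ gridCoordinates θ N j ∧ gridCoordinates θ N j ≤ 1 - ℓ := fun j hj => by
    rw [Finset.mem_attachFin, Finset.mem_Ico] at hj
    have h1 : (m : ℝ) ≤ (j : ℕ) := by exact_mod_cast hj.1
    have h2 : ((j : ℕ) : ℝ) + 1 + m ≤ N := by
      have : (j : ℕ) + 1 + m ≤ N := by omega
      exact_mod_cast this
    rw [Finset.mem_filter]
    refine ⟨Finset.mem_univ _, ?_, ?_⟩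
    · rw [gridCoordinates, le_div_iff₀ hN']; linarith [hθ.1]
    · rw [gridCoordinates, div_le_iff₀ hN']; linarith [hθ.2]
  have hcard := Finset.card_le_card hsub
  rw [Finset.card_attachFin, Nat.card_Ico] at hcard
  have h3 : N ≤ (Finset.univ.filter fun j : Fin N =>
      ℓ ≤ gridCoordinates θ N j ∧ gridCoordinates θ N j ≤ 1 - ℓ).card + 2 * m := by omega
  have h4 : (N : ℝ) ≤ (Finset.univ.filter fun j : Fin N =>
      ℓ ≤ gridCoordinates θ N j ∧ gridCoordinates θ N j ≤ 1 - ℓ).card + 2 * m := by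
    exact_mod_cast h3
  linarith

/-- Almost all equidistant coordinates keep a small distance from the end points of `[0, 1]`. -/
theorem exists_le_card_gridCoordinates {θ ε : ℝ} (hθ : θ ∈ Icc (0 : ℝ) 1) (hε : 0 < ε) :
    ∃ δ : ℝ, 0 < δ ∧ ∀ ℓ : ℝ, 0 ≤ ℓ → ℓ < δ → ∀ N : ℕ, 0 < N →
      (θ ∈ Ioo (0 : ℝ) 1 ∨ 1 / δ ≤ (N : ℝ)) →
        (1 - ε) * N ≤ (Finset.univ.filter fun j : Fin N =>
          ℓ ≤ gridCoordinates θ N j ∧ gridCoordinates θ N j ≤ 1 - ℓ).card := by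
  have large : ∀ ℓ : ℝ, 0 ≤ ℓ → ℓ < ε / 4 → ∀ N : ℕ, 0 < N → 1 / (ε / 4) ≤ (N : ℝ) →
      (1 - ε) * N ≤ (Finset.univ.filter fun j : Fin N =>
          ℓ ≤ gridCoordinates θ N j ∧ gridCoordinates θ N j ≤ 1 - ℓ).card := by
    intro ℓ h0 h1 N hN h2
    refine le_trans ?_ (sub_le_card_gridCoordinates hθ h0 hN)
    have hN' : 0 < (N : ℝ) := by exact_mod_cast hN
    rw [div_le_iff₀ (by positivity)] at h2
    nlinarith
  -- For small `N` no point may be lost: an interior `θ` keeps all of them at distance at least `min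
  -- θ (1 - θ) / N` from the ends. For `θ ∈ {0, 1}` one point is an end point, so `N` must be large.
  by_cases hI : θ ∈ Ioo (0 : ℝ) 1
  · have hmin : 0 < min θ (1 - θ) := lt_min hI.1 (by linarith [hI.2])
    refine ⟨min (ε / 4) (min θ (1 - θ) * (ε / 4)), by positivity, fun ℓ h0 h1 N hN _ => ?_⟩
    have hN' : 0 < (N : ℝ) := by exact_mod_cast hN
    rcases le_total (1 / (ε / 4)) (N : ℝ) with h2 | h2
    · exact large ℓ h0 (h1.trans_le (min_le_left _ _)) N hN h2
    · have h3 : ℓ * N ≤ min θ (1 - θ) := by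
        rw [le_div_iff₀ (by positivity)] at h2
        have := h1.le.trans (min_le_right _ _)
        calc ℓ * N ≤ min θ (1 - θ) * (ε / 4) * N := by gcongr
          _ = min θ (1 - θ) * (N * (ε / 4)) := by ring
          _ ≤ min θ (1 - θ) * 1 := by gcongr
          _ = _ := mul_one _
      rw [Finset.filter_true_of_mem]
      · simp only [Finset.card_univ, Fintype.card_fin]; nlinarith
      · intro j _
        have hj : ((j : ℕ) : ℝ) + 1 ≤ N := by exact_mod_cast j.isLt
        have hj0 : (0 : ℝ) ≤ (j : ℕ) := Nat.cast_nonneg _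
        have h4 := h3.trans (min_le_left _ _)
        have h5 := h3.trans (min_le_right _ _)
        refine ⟨?_, ?_⟩
        · rw [gridCoordinates, le_div_iff₀ hN']; linarith
        · rw [gridCoordinates, div_le_iff₀ hN']; linarith
  · refine ⟨ε / 4, by positivity, fun ℓ h0 h1 N hN h => ?_⟩
    exact large ℓ h0 h1 N hN (h.resolve_left hI)

theorem card_mul_le_sum_filter {ι : Type*} [Fintype ι] (p : ι → Prop) [DecidablePred p]
    {f : ι → ℝ} {c : ℝ} (h0 : ∀ j, 0 ≤ f j) (h : ∀ j, p j → c ≤ f j) :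
    (Finset.univ.filter p).card * c ≤ ∑ j, f j := by
  rw [← nsmul_eq_mul]
  refine (Finset.card_nsmul_le_sum _ _ _ fun j hj => h j (Finset.mem_filter.mp hj).2).trans ?_
  exact Finset.sum_le_sum_of_subset_of_nonneg (Finset.filter_subset _ _) fun j _ _ => h0 j

/-! ### Stable rank for equidistant coordinates -/

theorem min_eq_div_max {N W : ℝ} (hN : 0 < N) (hW : 0 < W) : min N W = N / max 1 (N / W) := by
  rcases le_total N W with h | h
  · rw [min_eq_left h, max_eq_left ((div_le_one hW).mpr h), div_one]
  · rw [min_eq_right h, max_eq_right ((one_le_div hW).mpr h), div_div_cancel₀ hN.ne']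

theorem thetaSum_le_mul_max {w R : ℝ} (hw : 0 < w) (hsmall : w ≤ 1 → thetaSum (1 / w ^ 2) ≤ R)
    (hlarge : 1 ≤ w → thetaSum (w ^ 2) ≤ R) : thetaSum (1 / w ^ 2) ≤ R * max 1 w := by
  rcases le_total w 1 with h | h
  · rw [max_eq_left h, mul_one]; exact hsmall h
  · rw [max_eq_right h, thetaSum_one_div_sq hw, mul_comm]
    gcongr
    exact hlarge h

theorem one_le_sqrt_pi : 1 ≤ √Real.pi := Real.one_le_sqrt.mpr (by linarith [Real.pi_gt_three])

theorem sqrt_pi_le_two : √Real.pi ≤ 2 := by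
  rw [Real.sqrt_le_left (by norm_num)]; linarith [Real.pi_le_four]

theorem sqrt_two_le_two : √(2 : ℝ) ≤ 2 := by
  rw [Real.sqrt_le_left (by norm_num)]; norm_num

theorem one_add_div_sq_le {e ε : ℝ} (he : 0 < e) (he1 : e ≤ 1 / 1000) (h : 10 * e ≤ ε) :
    (1 + e) / (1 - e) ^ 2 ≤ 1 + ε := by
  rw [div_le_iff₀ (pow_pos (by linarith) 2)]
  have : (1 + 10 * e) * (1 - e) ^ 2 ≤ (1 + ε) * (1 - e) ^ 2 := by gcongr
  nlinarith [pow_pos he 3]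

theorem one_sub_le_div_div {e ε : ℝ} (he : 0 < e) (h : 10 * e ≤ ε) :
    1 - ε ≤ (1 - e) / (1 + e) / (1 + e) := by
  rw [div_div, le_div_iff₀ (by positivity)]
  have : (1 - ε) * ((1 + e) * (1 + e)) ≤ (1 - 10 * e) * ((1 + e) * (1 + e)) := by gcongr
  nlinarith [pow_pos he 3]

theorem grid_scale_small_or_large {σ δ a : ℝ} {N : ℕ} (hσ : 0 < σ) (hδ : 0 < δ) (ha : 0 < a)
    (hδa : δ ≤ 1 / (4 * a)) (hsep : (N : ℝ) * σ ≤ δ ∨ 1 / δ ≤ (N : ℝ) * σ) :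
    2 * √Real.pi * σ * N * a ≤ 1 ∨ a ≤ 2 * √Real.pi * σ * N := by
  have hπ1 := one_le_sqrt_pi
  have hπ2 := sqrt_pi_le_two
  have hinv : 4 * a ≤ 1 / δ := (le_one_div hδ (by positivity)).mp hδa
  rw [le_div_iff₀ (by positivity)] at hδa
  refine hsep.imp (fun h => ?_) fun h => ?_
  · calc 2 * √Real.pi * σ * N * a = 2 * √Real.pi * (N * σ) * a := by ring
      _ ≤ 2 * 2 * δ * a := by gcongr
      _ ≤ 1 := by linarith
  · have h3 : 1 * (N * σ) ≤ √Real.pi * (N * σ) := by gcongr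
    linarith

/-- The columns for equidistant coordinates have on average almost the full Gaussian mass. -/
theorem le_sum_sampledMass_gridCoordinates {θ e L r ℓ : ℝ} {d N : ℕ} (hθ : θ ∈ Icc (0 : ℝ) 1)
    (he : 0 < e) (he1 : e ≤ 1) (hr : 0 < r) (hℓ : L * r ≤ ℓ)
    (hcard : (1 - e / 2) * N ≤ (Finset.univ.filter fun j : Fin N =>
      ℓ ≤ gridCoordinates θ N j ∧ gridCoordinates θ N j ≤ 1 - ℓ).card)
    (h : ∀ c ∈ Icc (0 : ℝ) 1, L * r ≤ c → c ≤ 1 - L * r →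
      (1 - e / 2) * (√Real.pi * r) ≤ sampledMass r d c) :
    N * ((1 - e) * (√Real.pi * r)) ≤ ∑ j, sampledMass r d (gridCoordinates θ N j) := by
  have := card_mul_le_sum_filter (fun j : Fin N => ℓ ≤ gridCoordinates θ N j
    ∧ gridCoordinates θ N j ≤ 1 - ℓ) (fun j => sampledMass_nonneg r d _)
    (fun j hj => h _ (gridCoordinates_mem_Icc hθ j) (hℓ.trans hj.1) (by linarith [hj.2]))
  refine le_trans ?_ this
  have hc : 0 ≤ (1 - e / 2) * (√Real.pi * r) := mul_nonneg (by linarith) (by positivity)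
  refine le_trans ?_ (mul_le_mul_of_nonneg_right hcard hc)
  have hNr : 0 ≤ e ^ 2 * (N * (√Real.pi * r)) := by positivity
  linarith

/-- The stable rank for equidistant coordinates. -/
theorem stableRank_gridCoordinates {θ : ℝ} (hθ : θ ∈ Icc (0 : ℝ) 1) {ε : ℝ} (hε : 0 < ε) :
    ∃ δ : ℝ, 0 < δ ∧
      ∀ σ : ℝ, 0 < σ → σ < δ → ∃ d₀ : ℕ, ∀ d : ℕ, d₀ ≤ d → ∀ N : ℕ, 1 ≤ N →
        (θ ∈ Ioo (0 : ℝ) 1 ∨ 1 / δ ≤ (N : ℝ)) →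
          ((N : ℝ) * σ ≤ δ ∨ 1 / δ ≤ (N : ℝ) * σ →
            |stableRank (gaussianEmbeddingMatrix σ d (gridCoordinates θ N))
                - min (N : ℝ) (1 / (2 * √Real.pi * σ))|
              ≤ ε * min (N : ℝ) (1 / (2 * √Real.pi * σ))) ∧
          (9 / 10 : ℝ) * min (N : ℝ) (1 / (2 * √Real.pi * σ))
            ≤ stableRank (gaussianEmbeddingMatrix σ d (gridCoordinates θ N)) ∧
          stableRank (gaussianEmbeddingMatrix σ d (gridCoordinates θ N))
            ≤ (1 + ε) * min (N : ℝ) (1 / (2 * √Real.pi * σ)) := by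
  -- The final losses are products of three factors `1 ± e`, about `3e` in all, so `10 * e ≤ ε` is
  -- ample; `e ≤ 1/1000` keeps `(1 - e) / (1 + e) / 1.1` above `9/10`.
  obtain ⟨e, he, he1, he2⟩ : ∃ e : ℝ, 0 < e ∧ e ≤ 1 / 1000 ∧ 10 * e ≤ ε :=
    ⟨min (ε / 10) (1 / 1000), by positivity, min_le_right _ _, by
      linarith [min_le_left (ε / 10) (1 / 1000)]⟩
  obtain ⟨a₀, ha₀, hθa⟩ := exists_thetaSum_le he
  obtain ⟨L, hL, hmass⟩ := exists_sampledMass_bounds (half_pos he)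
  obtain ⟨δ₁, hδ₁, hgrid⟩ := exists_le_card_gridCoordinates hθ (half_pos he)
  have ha₀pos : 0 < a₀ := by linarith
  refine ⟨min δ₁ (min (δ₁ / (2 * L)) (1 / (4 * a₀))), by positivity, fun σ hσ hσδ => ?_⟩
  set δ := min δ₁ (min (δ₁ / (2 * L)) (1 / (4 * a₀)))
  have hδ : 0 < δ := by positivity
  have hδδ₁ : δ ≤ δ₁ := min_le_left _ _
  have hδL : δ ≤ δ₁ / (2 * L) := (min_le_right _ _).trans (min_le_left _ _)
  have hδa : δ ≤ 1 / (4 * a₀) := (min_le_right _ _).trans (min_le_right _ _)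
  have h2σ : 0 < √2 * σ := by positivity
  obtain ⟨d₁, hd₁pos, hd₁⟩ := hmass σ hσ
  obtain ⟨d₂, -, hd₂⟩ := hmass (√2 * σ) h2σ
  refine ⟨max d₁ d₂, fun d hd N hN hor => ?_⟩
  have hN' : 0 < (N : ℝ) := by exact_mod_cast hN
  have hx := gridCoordinates_mem_Icc (N := N) hθ
  have hσ2 : σ ≤ √2 * σ := by nlinarith [Real.one_le_sqrt.mpr (one_le_two (α := ℝ))]
  have hcard := hgrid (L * (√2 * σ)) (by positivity) (by
    rw [le_div_iff₀ (by positivity)] at hδL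
    have : L * (√2 * σ) ≤ σ * (2 * L) := by nlinarith [sqrt_two_le_two, mul_pos hL hσ]
    refine this.trans_lt (lt_of_lt_of_le ?_ hδL)
    gcongr) N hN (hor.imp_right fun h => le_trans (by gcongr) h)
  obtain ⟨hupper, hlower⟩ := stableRank_gaussianEmbeddingMatrix_bounds (ε := e) hσ he (by linarith)
    (hd₁pos.trans_le ((le_max_left _ _).trans hd)) hN hx
    (fun c hc => (hd₁ d ((le_max_left _ _).trans hd) c hc).1.trans (by gcongr; linarith))
    (le_sum_sampledMass_gridCoordinates hθ he (by linarith) hσ (by gcongr) hcard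
      fun c hc => (hd₁ d ((le_max_left _ _).trans hd) c hc).2)
    (le_sum_sampledMass_gridCoordinates hθ he (by linarith) h2σ le_rfl hcard
      fun c hc => (hd₂ d ((le_max_right _ _).trans hd) c hc).2)
  set sr := stableRank (gaussianEmbeddingMatrix σ d (gridCoordinates θ N)) with hsr
  set W := 1 / (2 * √Real.pi * σ) with hW
  have hWpos : 0 < W := by positivity
  have hw : 2 * √Real.pi * σ * N = N / W := by rw [hW]; field_simp
  set w := N / W with hwdef
  have hwpos : 0 < w := by positivity
  have hmpos : 0 < min (N : ℝ) W := lt_min hN' hWpos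
  have hge : ∀ R : ℝ, 0 < R → (w ≤ 1 → thetaSum (1 / w ^ 2) ≤ R) →
      (1 ≤ w → thetaSum (w ^ 2) ≤ R) → (1 - e) / (1 + e) / R * min (N : ℝ) W ≤ sr := by
    intro R hR h1 h2
    have h3 := hlower (R * max 1 w) (by positivity) fun j => (sum_exp_grid_le hσ j).trans (by
      rw [hw]; exact thetaSum_le_mul_max hwpos h1 h2)
    rw [min_eq_div_max hN' hWpos]
    refine le_of_eq_of_le ?_ h3
    rw [← hwdef]
    ring
  have hle : sr ≤ (1 + ε) * min (N : ℝ) W := by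
    rw [mul_min_of_nonneg _ _ (by linarith)]
    refine le_min ((stableRank_le_card _).trans (by nlinarith)) (hupper.trans ?_)
    gcongr
    exact one_add_div_sq_le he he1 he2
  refine ⟨fun hsep => ?_, ?_, hle⟩
  · have hsepw : w * a₀ ≤ 1 ∨ a₀ ≤ w := by
      rw [← hw]; exact grid_scale_small_or_large hσ hδ ha₀pos hδa hsep
    -- Away from the crossover `w = 1`, the theta argument (`1 / w²` or `w²`, whichever is at least
    -- 1) exceeds or equals `a₀`. The mixed cases can only occur when `w = a₀ = 1`.
    have hge' := hge (1 + e) (by linarith)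
      (fun h => hθa _ (by
        rw [le_div_iff₀ (by positivity)]
        have h0 : w ^ 2 ≤ w := pow_le_of_le_one hwpos.le h two_ne_zero
        rcases hsepw with h1 | h1
        · exact (mul_le_mul_of_nonneg_left h0 ha₀pos.le).trans ((mul_comm _ _).trans_le h1)
        · exact mul_le_one₀ (h1.trans h) (by positivity) (h0.trans h)))
      (fun h => hθa _ (by
        have h0 : w ≤ w ^ 2 := le_self_pow₀ h two_ne_zero
        rcases hsepw with h1 | h1
        · exact ((le_mul_of_one_le_left ha₀pos.le h).trans h1).trans (h.trans h0)
        · exact h1.trans h0))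
    have := mul_le_mul_of_nonneg_right (one_sub_le_div_div he he2) hmpos.le
    rw [abs_le]
    constructor <;> linarith
  · refine le_trans ?_ (hge (1 + 1 / 10) (by norm_num)
      (fun h => thetaSum_le_of_one_le ?_) (fun h => thetaSum_le_of_one_le ?_))
    · refine mul_le_mul_of_nonneg_right ?_ hmpos.le
      rw [div_div, le_div_iff₀ (by positivity)]
      linarith
    · rw [le_div_iff₀ (by positivity), one_mul]
      exact pow_le_one₀ hwpos.le h
    · exact one_le_pow₀ h

/-! ### Fixed distinct coordinates as `σ → 0` -/

/-- The stable rank for finitely many distinct coordinates. -/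
theorem stableRank_of_injective {N : ℕ} {x : Fin N → ℝ} (hinj : Function.Injective x)
    (hx : ∀ j, x j ∈ Ioo (0 : ℝ) 1) {ε : ℝ} (hε : 0 < ε) :
    ∃ δ : ℝ, 0 < δ ∧
      ∀ σ : ℝ, 0 < σ → σ < δ → ∃ d₀ : ℕ, ∀ d : ℕ, d₀ ≤ d →
        |stableRank (gaussianEmbeddingMatrix σ d x) - min (N : ℝ) (1 / (2 * √Real.pi * σ))|
          ≤ ε * min (N : ℝ) (1 / (2 * √Real.pi * σ)) := by
  rcases N.eq_zero_or_pos with rfl | hN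
  · refine ⟨1, one_pos, fun σ hσ _ => ⟨0, fun d _ => ?_⟩⟩
    have h1 := stableRank_le_card (gaussianEmbeddingMatrix σ d x)
    have h2 := stableRank_nonneg (gaussianEmbeddingMatrix σ d x)
    have h3 : 0 ≤ 1 / (2 * √Real.pi * σ) := by positivity
    rw [Nat.cast_zero] at h1 ⊢
    rw [min_eq_left h3, le_antisymm h1 h2]
    simp
  have hN' : 0 < (N : ℝ) := by exact_mod_cast hN
  have hπ2 := sqrt_pi_le_two
  obtain ⟨e, he, he1, he2⟩ : ∃ e : ℝ, 0 < e ∧ e ≤ 1 / 1000 ∧ 10 * e ≤ ε :=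
    ⟨min (ε / 10) (1 / 1000), by positivity, min_le_right _ _, by
      linarith [min_le_left (ε / 10) (1 / 1000)]⟩
  obtain ⟨L, hL, hmass⟩ := exists_sampledMass_bounds he
  have hlt : ∀ a : ℝ, 0 < a → ∀ᶠ σ : ℝ in nhdsWithin (0 : ℝ) (Ioi (0 : ℝ)), σ < a := fun a ha =>
    Filter.mem_of_superset (Ioo_mem_nhdsGT ha) fun σ hσ => hσ.2
  -- These conditions give, in turn: `m = N`, since `2√π ≤ 4`; nearly full column masses at both
  -- widths `σ` and `√2 σ`; and Gram row sums at most `1 + e` after normalization.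
  have hev : ∀ᶠ σ : ℝ in nhdsWithin (0 : ℝ) (Ioi (0 : ℝ)), σ < 1 / (4 * N) ∧
      (∀ j, σ < x j / (2 * L) ∧ σ < (1 - x j) / (2 * L)) ∧
      ∀ j k, j ≠ k → Real.exp (-(x j - x k) ^ 2 / (4 * σ ^ 2)) ≤ e / N := by
    refine (hlt _ (by positivity)).and (Filter.Eventually.and ?_ ?_)
    · refine Filter.eventually_all.mpr fun j => (hlt _ ?_).and (hlt _ ?_)
      · exact div_pos (hx j).1 (by positivity)
      · exact div_pos (by linarith [(hx j).2]) (by positivity)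
    · refine Filter.eventually_all.mpr fun j => Filter.eventually_all.mpr fun k => ?_
      by_cases hjk : j = k
      · exact Filter.Eventually.of_forall fun _ h => absurd hjk h
      have hg : 0 < (x j - x k) ^ 2 := sq_pos_of_ne_zero (sub_ne_zero.mpr (hinj.ne hjk))
      filter_upwards [hlt 1 one_pos, hlt ((x j - x k) ^ 2 * (e / N) / 4) (by positivity),
        self_mem_nhdsWithin] with σ h1 h2 h3 _
      have h3 : 0 < σ := h3
      set y := (x j - x k) ^ 2 / (4 * σ ^ 2) with hy
      -- The crude bound `exp (-y) ≤ 1 / y` suffices: `1 / y` is `4σ² / (x j - x k)²`, and `σ² ≤ σ`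
      -- because `σ < 1`.
      have hypos : 0 < y := by positivity
      have h4 : Real.exp (-y) ≤ 1 / y := by
        rw [Real.exp_neg, inv_eq_one_div]
        exact one_div_le_one_div_of_le hypos (by linarith [Real.add_one_le_exp y])
      rw [neg_div, ← hy]
      refine h4.trans ?_
      rw [hy, one_div_div, div_le_iff₀ hg]
      nlinarith
  obtain ⟨δ, hδ, hδev⟩ := mem_nhdsGT_iff_exists_Ioo_subset.mp hev
  refine ⟨δ, hδ, fun σ hσ hσδ => ?_⟩
  obtain ⟨hσN, hend, hoff⟩ := hδev ⟨hσ, hσδ⟩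
  have h2σ : 0 < √2 * σ := by positivity
  obtain ⟨d₁, hd₁pos, hd₁⟩ := hmass σ hσ
  obtain ⟨d₂, -, hd₂⟩ := hmass (√2 * σ) h2σ
  refine ⟨max d₁ d₂, fun d hd => ?_⟩
  have hx' : ∀ j, x j ∈ Icc (0 : ℝ) 1 := fun j => Ioo_subset_Icc_self (hx j)
  have hmean : ∀ r : ℝ, r ≤ 2 * σ → (∀ c ∈ Icc (0 : ℝ) 1, L * r ≤ c → c ≤ 1 - L * r →
      (1 - e) * (√Real.pi * r) ≤ sampledMass r d c) →
      N * ((1 - e) * (√Real.pi * r)) ≤ ∑ j, sampledMass r d (x j) := by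
    intro r hrσ h
    have hLr : L * r ≤ L * (2 * σ) := by gcongr
    have := Finset.sum_le_sum fun j (_ : j ∈ Finset.univ) => by
      obtain ⟨h1, h2⟩ := hend j
      rw [lt_div_iff₀ (by positivity)] at h1 h2
      exact h (x j) (hx' j) (by linarith) (by linarith)
    simpa using this
  obtain ⟨-, hlower⟩ := stableRank_gaussianEmbeddingMatrix_bounds (ε := e) hσ he (by linarith)
    (hd₁pos.trans_le ((le_max_left _ _).trans hd)) hN hx'
    (fun c hc => (hd₁ d ((le_max_left _ _).trans hd) c hc).1)
    (hmean σ (by linarith) fun c hc => (hd₁ d ((le_max_left _ _).trans hd) c hc).2)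
    (hmean _ (by gcongr; exact sqrt_two_le_two)
      fun c hc => (hd₂ d ((le_max_right _ _).trans hd) c hc).2)
  have hrow : ∀ j, ∑ k, Real.exp (-(x j - x k) ^ 2 / (4 * σ ^ 2)) ≤ 1 + e := by
    intro j
    have h1 : ∀ k ∈ Finset.univ, Real.exp (-(x j - x k) ^ 2 / (4 * σ ^ 2))
        ≤ (if k = j then 1 else 0) + e / N := fun k _ => by
      split_ifs with hkj
      · subst hkj
        have : 0 < e / N := by positivity
        simp [this.le]
      · rw [zero_add]; exact hoff j k (Ne.symm hkj)
    refine (Finset.sum_le_sum h1).trans_eq ?_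
    simp [Finset.sum_add_distrib]
    field_simp
  have hmin : min (N : ℝ) (1 / (2 * √Real.pi * σ)) = N := by
    refine min_eq_left ?_
    rw [lt_div_iff₀ (by positivity)] at hσN
    rw [le_div_iff₀ (by positivity)]
    have : √Real.pi * (σ * N) ≤ 2 * (σ * N) := by gcongr
    linarith
  have h1 := hlower (1 + e) (by linarith) hrow
  have h2 := stableRank_le_card (gaussianEmbeddingMatrix σ d x)
  have h3 := mul_le_mul_of_nonneg_right (one_sub_le_div_div he he2) hN'.le
  rw [hmin, abs_le]
  have h4 : (1 - e) / (1 + e) / (1 + e) * N = (1 - e) / (1 + e) * (N / (1 + e)) := by ring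
  constructor <;> nlinarith

/-! ### Embedded distances on the unit interval -/

/-- The embedded distance on the unit interval. -/
theorem embeddedDistance_and_sampledDistance {a b : ℝ} (ha : 0 < a) (hb : b < 1) {ε : ℝ}
    (hε : 0 < ε) : ∃ δ : ℝ, 0 < δ ∧
      ∀ σ : ℝ, 0 < σ → σ < δ →
        (∀ x₁ ∈ Icc a b, ∀ x₂ ∈ Icc a b,
          |embeddedDistance (Icc 0 1) σ x₁ x₂
              - √Real.pi * σ * Real.exp (-|x₁ - x₂| ^ 2 / (4 * σ ^ 2))|
            ≤ ε * (√Real.pi * σ * Real.exp (-|x₁ - x₂| ^ 2 / (4 * σ ^ 2)))) ∧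
        ∃ d₀ : ℕ, ∀ d : ℕ, d₀ ≤ d → ∀ x₁ ∈ Icc a b, ∀ x₂ ∈ Icc a b,
          |sampledDistance σ d x₁ x₂
              - √Real.pi * σ * Real.exp (-|x₁ - x₂| ^ 2 / (4 * σ ^ 2))|
            ≤ ε * (√Real.pi * σ * Real.exp (-|x₁ - x₂| ^ 2 / (4 * σ ^ 2))) := by
  obtain ⟨L₁, hL₁, hint⟩ := exists_le_gaussianMass hε
  obtain ⟨L₂, hL₂, hsam⟩ := exists_sampledMass_bounds hε
  have hc : 0 < min a (1 - b) := lt_min ha (by linarith)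
  have key : ∀ c m σ : ℝ, 0 ≤ c → (1 - ε) * (√Real.pi * σ) ≤ m → m ≤ (1 + ε) * (√Real.pi * σ) →
      |c * m - √Real.pi * σ * c| ≤ ε * (√Real.pi * σ * c) := by
    intro c m σ h0 h1 h2
    rw [abs_le]
    constructor <;> nlinarith
  refine ⟨min (min a (1 - b) / L₁) (min a (1 - b) / L₂), by positivity, fun σ hσ hσδ => ?_⟩
  have h1 := (lt_div_iff₀ hL₁).mp (hσδ.trans_le (min_le_left _ _))
  have h2 := (lt_div_iff₀ hL₂).mp (hσδ.trans_le (min_le_right _ _))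
  -- Midpoints stay in `[a, b]`, so the relative error of the mass is uniform; the factor `exp (-(x
  -- - y)² / (4σ²))` is common to both sides, however small.
  have hmid : ∀ L : ℝ, σ * L < min a (1 - b) → ∀ x ∈ Icc a b, ∀ y ∈ Icc a b,
      L * σ ≤ (x + y) / 2 ∧ (x + y) / 2 ≤ 1 - L * σ := by
    intro L h x hx y hy
    have h3 := h.trans_le (min_le_left _ _)
    have h4 := h.trans_le (min_le_right _ _)
    constructor <;> linarith [hx.1, hx.2, hy.1, hy.2]
  refine ⟨fun x hx y hy => ?_, ?_⟩
  · obtain ⟨h3, h4⟩ := hmid L₁ h1 x hx y hy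
    rw [embeddedDistance_Icc, sq_abs]
    refine key _ _ _ (Real.exp_pos _).le (hint σ _ hσ h3 h4) ((gaussianMass_le hσ).trans ?_)
    have : 0 < √Real.pi * σ := by positivity
    nlinarith
  · obtain ⟨d₀, -, hd₀⟩ := hsam σ hσ
    refine ⟨d₀, fun d hd x hx y hy => ?_⟩
    obtain ⟨h3, h4⟩ := hmid L₂ h2 x hx y hy
    obtain ⟨h5, h6⟩ := hd₀ d hd ((x + y) / 2) ⟨by linarith [hx.1, hy.1], by linarith [hx.2, hy.2]⟩
    rw [sampledDistance_eq, sq_abs]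
    exact key _ _ _ (Real.exp_pos _).le (h6 h3 h4) h5

theorem proposition2 :
    -- the stable rank, for equidistant coordinates
    (∀ θ ∈ Icc (0 : ℝ) 1, ∀ ε : ℝ, 0 < ε → ∃ δ : ℝ, 0 < δ ∧
      ∀ σ : ℝ, 0 < σ → σ < δ → ∃ d₀ : ℕ, ∀ d : ℕ, d₀ ≤ d → ∀ N : ℕ, 1 ≤ N →
        (θ ∈ Ioo (0 : ℝ) 1 ∨ 1 / δ ≤ (N : ℝ)) →
          ((N : ℝ) * σ ≤ δ ∨ 1 / δ ≤ (N : ℝ) * σ →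
            |stableRank (gaussianEmbeddingMatrix σ d (gridCoordinates θ N))
                - min (N : ℝ) (1 / (2 * √Real.pi * σ))|
              ≤ ε * min (N : ℝ) (1 / (2 * √Real.pi * σ))) ∧
          (9 / 10 : ℝ) * min (N : ℝ) (1 / (2 * √Real.pi * σ))
            ≤ stableRank (gaussianEmbeddingMatrix σ d (gridCoordinates θ N)) ∧
          stableRank (gaussianEmbeddingMatrix σ d (gridCoordinates θ N))
            ≤ (1 + ε) * min (N : ℝ) (1 / (2 * √Real.pi * σ))) ∧
    -- the stable rank, for a fixed number of arbitrary distinct coordinates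
    (∀ (N : ℕ) (x : Fin N → ℝ), Function.Injective x → (∀ j, x j ∈ Ioo (0 : ℝ) 1) →
      ∀ ε : ℝ, 0 < ε → ∃ δ : ℝ, 0 < δ ∧
        ∀ σ : ℝ, 0 < σ → σ < δ → ∃ d₀ : ℕ, ∀ d : ℕ, d₀ ≤ d →
          |stableRank (gaussianEmbeddingMatrix σ d x) - min (N : ℝ) (1 / (2 * √Real.pi * σ))|
            ≤ ε * min (N : ℝ) (1 / (2 * √Real.pi * σ))) ∧
    -- the embedded distance, with the integral over the whole line
    (∀ σ : ℝ, 0 < σ → ∀ x₁ x₂ : ℝ,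
      embeddedDistance univ σ x₁ x₂
        = √Real.pi * σ * Real.exp (-|x₁ - x₂| ^ 2 / (4 * σ ^ 2))) ∧
    -- the embedded distance on the unit interval, as an integral and from the embedding vectors
    (∀ a b : ℝ, 0 < a → b < 1 → ∀ ε : ℝ, 0 < ε → ∃ δ : ℝ, 0 < δ ∧
      ∀ σ : ℝ, 0 < σ → σ < δ →
        (∀ x₁ ∈ Icc a b, ∀ x₂ ∈ Icc a b,
          |embeddedDistance (Icc 0 1) σ x₁ x₂
              - √Real.pi * σ * Real.exp (-|x₁ - x₂| ^ 2 / (4 * σ ^ 2))|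
            ≤ ε * (√Real.pi * σ * Real.exp (-|x₁ - x₂| ^ 2 / (4 * σ ^ 2)))) ∧
        ∃ d₀ : ℕ, ∀ d : ℕ, d₀ ≤ d → ∀ x₁ ∈ Icc a b, ∀ x₂ ∈ Icc a b,
          |sampledDistance σ d x₁ x₂
              - √Real.pi * σ * Real.exp (-|x₁ - x₂| ^ 2 / (4 * σ ^ 2))|
            ≤ ε * (√Real.pi * σ * Real.exp (-|x₁ - x₂| ^ 2 / (4 * σ ^ 2)))) := by
  exact ⟨fun _ hθ _ hε => stableRank_gridCoordinates hθ hε,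
    fun _ _ hinj hx _ hε => stableRank_of_injective hinj hx hε,
    fun _ hσ x₁ x₂ => embeddedDistance_univ hσ x₁ x₂,
    fun _ _ ha hb _ hε => embeddedDistance_and_sampledDistance ha hb hε⟩
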